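/- **Theorem 2.4.** *Conventions.* A Hackenbush position is a finite graph (loops and parallel edges allowed) with edges coloured blue, red or green, together with a set of vertices designated as the ground. Left and Right alternately cut edges, Left cutting only blue or green edges and Right only red or green edges; components not connected to the ground are discarded. Under normal play the last player to move wins; under misère play the last player to move loses. Write $o^+(G)$ and $o^-(G)$ for the outcome class of $G$ under normal and misère play, namely $\mathcal N$ (the next player wins), $\mathcal P$ (the previous player wins), $\mathcal L$ (Left wins) or $\mathcal R$ (Right wins). The disjunctive sum of Hackenbush positions is the disjoint union of the graphs, with ground the union of the grounds. The Stalk of height $n\ge 0$ is a path of $n$ green edges with one end (and no other vertex) on the ground, and $*$ is the Stalk of height $1$. A Shrub is a position all of whose edges are green and which has a root vertex of degree one (a loop counts twice) that is the only vertex on the ground. Two games $G,H$ are equivalent under misère play if $o^-(G+X)=o^-(H+X)$ for every (partizan) game $X$, where $+$ is the disjunctive sum of games. *Statement.* Let $S=S_1+\dots+S_k$ ($k\ge 0$) be a disjunctive sum of Shrubs. Then each $S_i$ is equivalent under misère play to the Stalk of exactly one height $h_i$. Hence the evil twin $$S^*=\begin{cases} S & \text{if } h_i\ge 2 \text{ for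 some } i,\\ S+* & \text{otherwise,}\end{cases}$$ is well defined, and $$o^+(S)=o^-(S^*)\qquad\text{and}\qquad o^+(S^*)=o^-(S).$$ -/

import Mathlib

namespace Hackenbush

/-! ### Combinatorial games and their outcomes -/

/-- A (well-founded, partizan) game `{left options | right options}`. -/
inductive Game : Type 1
  | mk (L R : Type) (left : L → Game) (right : R → Game) : Game

namespace Game

/-- Disjunctive sum, `G + H = {G^L + H, G + H^L | G^R + H, G + H^R}`. The recursive equation is
`Game.mk_add_mk` below. -/
noncomputable def add (G H : Game) : Game :=
  Game.rec (motive := fun _ => Game → Game)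
    (fun L R _ _ addL addR H =>
      Game.rec (motive := fun _ => Game)
        (fun L' R' l' r' addL' addR' =>
          mk (L ⊕ L') (R ⊕ R')
            (Sum.elim (fun i => addL i (mk L' R' l' r')) addL')
            (Sum.elim (fun i => addR i (mk L' R' l' r')) addR'))
        H)
    G H

noncomputable instance : Add Game := ⟨add⟩

theorem mk_add_mk (L R L' R' : Type) (l : L → Game) (r : R → Game)
    (l' : L' → Game) (r' : R' → Game) :
    mk L R l r + mk L' R' l' r' =
      mk (L ⊕ L') (R ⊕ R')
        (Sum.elim (fun i => l i + mk L' R' l' r') (fun j => mk L R l r + l' j))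
        (Sum.elim (fun i => r i + mk L' R' l' r') (fun j => mk L R l r + r' j)) :=
  rfl

end Game

inductive Player
  | left
  | right

/-- Under normal play the last player to move wins; under misère play that player loses. -/
inductive Convention
  | normal
  | misere

/-- `WinsFirst c G p`: under the convention `c`, player `p` wins `G` when `p` is to move.
A player who is to move and has no move loses under normal play and wins under misère play. -/
def WinsFirst (c : Convention) : Game → Player → Prop
  | .mk L _ l _, .left =>
      (c = .misere ∧ IsEmpty L) ∨ ∃ i, ¬ WinsFirst c (l i) .right
  | .mk _ R _ r, .right =>
      (c = .misere ∧ IsEmpty R) ∨ ∃ j, ¬ WinsFirst c (r j) .left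

/-- The four outcome classes: next player, previous player, Left, Right wins. -/
inductive Outcome
  | N
  | P
  | L
  | R

open Classical in
/-- The outcome class of a game under a play convention. -/
noncomputable def outcome (c : Convention) (G : Game) : Outcome :=
  if WinsFirst c G .left then
    if WinsFirst c G .right then .N else .L
  else
    if WinsFirst c G .right then .R else .P

/-- Equality of games under misère play, in the universe of all games. -/
def MisereEquiv (G H : Game) : Prop :=
  ∀ X : Game, outcome .misere (G + X) = outcome .misere (H + X)

/-! ### Hackenbush -/

inductive Color
  | blue
  | red
  | green

/-- A Hackenbush position: a finite graph (loops and parallel edges allowed) with coloured edges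
and a set of vertices designated to be the ground. -/
structure Position : Type 1 where
  V : Type
  E : Type
  finV : Fintype V
  finE : Fintype E
  ends : E → Sym2 V
  color : E → Color
  ground : Set V

attribute [instance] Position.finV Position.finE

namespace Position

/-- The vertex `v` is connected to the ground by edges in `s`. -/
def Reached (P : Position) (s : Finset P.E) (v : P.V) : Prop :=
  ∃ g ∈ P.ground, Relation.ReflTransGen (fun x y => ∃ e ∈ s, P.ends e = s(x, y)) g v

open Classical in
/-- What is left of the edge set `s` when all components not connected to the ground are
discarded. -/
noncomputable def prune (P : Position) (s : Finset P.E) : Finset P.E :=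
  s.filter fun e => ∃ v ∈ P.ends e, P.Reached s v

open Classical in
/-- The edge set that remains when `e` is cut and then all components no longer connected to the
ground are discarded. -/
noncomputable def cut (P : Position) (s : Finset P.E) (e : P.E) : Finset P.E :=
  P.prune (s.erase e)

theorem card_cut_lt (P : Position) (s : Finset P.E) (e : P.E) (he : e ∈ s) :
    (P.cut s e).card < s.card := by
  classical
  unfold cut prune
  refine lt_of_le_of_lt (Finset.card_filter_le _ _) ?_
  convert Finset.card_erase_lt_of_mem he

/-- The game played from the stage where the edges in `s` are present: Left cuts a blue or green
edge, Right cuts a red or green edge. -/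
noncomputable def gameFrom (P : Position) (s : Finset P.E) : Game :=
  Game.mk {e : P.E // e ∈ s ∧ P.color e ≠ .red} {e : P.E // e ∈ s ∧ P.color e ≠ .blue}
    (fun e => P.gameFrom (P.cut s e.1)) (fun e => P.gameFrom (P.cut s e.1))
termination_by s.card
decreasing_by
  · exact P.card_cut_lt s e.1 e.2.1
  · exact P.card_cut_lt s e.1 e.2.1

/-- The game of a Hackenbush position (components not connected to the ground do not count). -/
noncomputable def game (P : Position) : Game :=
  P.gameFrom (P.prune Finset.univ)

/-- Degree of a vertex; a loop counts twice. -/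
noncomputable def degree (P : Position) (v : P.V) : ℕ :=
  Nat.card {e : P.E // v ∈ P.ends e} + Nat.card {e : P.E // P.ends e = s(v, v)}

/-- A Shrub: all edges are green, and there is a root vertex which has degree one and is the only
vertex on the ground. -/
def IsShrub (P : Position) : Prop :=
  (∀ e, P.color e = .green) ∧ ∃ r, P.ground = {r} ∧ P.degree r = 1

/-- The Stalk of height `n`: a green path with `n` edges and one end on the ground. -/
def stalk (n : ℕ) : Position where
  V := Fin (n + 1)
  E := Fin n
  finV := inferInstance
  finE := inferInstance
  ends i := s(i.castSucc, i.succ)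
  color _ := .green
  ground := {0}

/-- The game `*`. -/
def star : Position := stalk 1

/-- The empty position. -/
def zero : Position where
  V := Empty
  E := Empty
  finV := inferInstance
  finE := inferInstance
  ends := Empty.elim
  color := Empty.elim
  ground := ∅

/-- Disjunctive sum of positions: the disjoint union of the graphs and of the grounds. -/
def add (P Q : Position) : Position where
  V := P.V ⊕ Q.V
  E := P.E ⊕ Q.E
  finV := inferInstance
  finE := inferInstance
  ends := Sum.elim (fun e => (P.ends e).map Sum.inl) (fun e => (Q.ends e).map Sum.inr)
  color := Sum.elim P.color Q.color
  ground := Sum.inl '' P.ground ∪ Sum.inr '' Q.ground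

/-- Disjunctive sum `S₁ + ⋯ + Sₖ` of a finite (possibly empty) list of positions. -/
def sum (l : List Position) : Position :=
  l.foldr add zero

/-- The outcome `o⁺` under normal play. -/
noncomputable def outcomeNormal (P : Position) : Outcome := outcome .normal P.game

/-- The outcome `o⁻` under misère play. -/
noncomputable def outcomeMisere (P : Position) : Outcome := outcome .misere P.game

/-- The position is equal, under misère play and in the universe of all games, to the Stalk of
height `n`. -/
def EquivStalk (P : Position) (n : ℕ) : Prop :=
  MisereEquiv P.game (stalk n).game

open Classical in
/-- The evil twin of a disjunctive sum `S` of Shrubs, given by the list of its summands: it is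
`S` if the Stalk equivalent to some summand has height at least `2`, and `S + *` otherwise. -/
noncomputable def evilTwin (l : List Position) : Position :=
  if ∃ S ∈ l, ∃ n, 2 ≤ n ∧ S.EquivStalk n then sum l else (sum l).add star

end Position

end Hackenbush

/-! Cutting the root edge of a Shrub leaves nothing, while any other cut keeps the root edge. So
every nonempty stage has a move to the empty stage, and the mex of the sizes of its options is
positive. The mex rule survives misère play when games of size 0 have no options at all: a move to a
smaller size is copied, a move to a larger size is reversed. Hence each Shrub is a nim heap in
disguise (`IsShrub.exists_isHeap`) and equals the Stalk of the same size in every context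
(`IsHeap.misereEquiv`).

For the outcomes, each sum carries a normal Grundy value and a flag. If all heaps have size at most
1 (fickle), the misère Grundy value is the normal one xor 1; otherwise (firm) the two values agree.
`IsTame` axiomatises this pair, and `IsTame.add` shows that values add by xor while a sum is fickle
only if both summands are. A player to move wins exactly when the relevant value is nonzero. For a
firm sum both outcomes therefore coincide; for a fickle sum, adding `*` exchanges the two values.
This is the evil twin. -/

namespace Hackenbush

/-! ### Options of either player and outcomes -/

/-- The opponent of a player. -/
def Player.other : Player → Player
  | .left => .right
  | .right => .left

theorem Player.other_other (p : Player) : p.other.other = p := by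
  cases p <;> rfl

namespace Game

/-- `G'` is an option of `G` for the player `p`. -/
def Opt : Player → Game → Game → Prop
  | .left, .mk _ _ l _, G' => ∃ i, l i = G'
  | .right, .mk _ _ _ r, G' => ∃ j, r j = G'

theorem opt_induction {motive : Game → Prop}
    (step : ∀ G, (∀ p G', Opt p G G' → motive G') → motive G) (G : Game) : motive G := by
  induction G with
  | mk L R l r ihl ihr =>
    apply step
    rintro (_ | _) G' ⟨i, rfl⟩
    · exact ihl i
    · exact ihr i

/-- Reversing a move replaces a game by an option of an option, so the hypothesis must reach two
moves deep. -/
theorem opt_induction₂ {motive : Game → Prop}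
    (step : ∀ G, (∀ p G', Opt p G G' → motive G') →
      (∀ p q G' G'', Opt p G G' → Opt q G' G'' → motive G'') → motive G) (G : Game) :
    motive G := by
  suffices h : motive G ∧ ∀ p G', Opt p G G' → motive G' from h.1
  induction G using opt_induction with
  | step G ih =>
    exact ⟨step G (fun p G' h => (ih p G' h).1) fun p q G' G'' h h' => (ih p G' h).2 q G'' h',
      fun p G' h => (ih p G' h).1⟩

theorem opt_add {p : Player} {G H K : Game} :
    Opt p (G + H) K ↔ (∃ G', Opt p G G' ∧ K = G' + H) ∨ ∃ H', Opt p H H' ∧ K = G + H' := by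
  obtain ⟨L, R, l, r⟩ := G
  obtain ⟨L', R', l', r'⟩ := H
  rw [mk_add_mk]
  cases p <;> simp [Opt, eq_comm]

end Game

open Game

theorem winsFirst_iff {c : Convention} {G : Game} {p : Player} :
    WinsFirst c G p ↔ (c = .misere ∧ ∀ G', ¬ Opt p G G') ∨
      ∃ G', Opt p G G' ∧ ¬ WinsFirst c G' p.other := by
  obtain ⟨L, R, l, r⟩ := G
  cases p <;> simp [Opt, WinsFirst, Player.other, isEmpty_iff]

theorem outcome_eq_of_winsFirst_iff {c c' : Convention} {G H : Game}
    (h : ∀ p, WinsFirst c G p ↔ WinsFirst c' H p) : outcome c G = outcome c' H := by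
  have hl := h .left
  have hr := h .right
  unfold outcome
  split_ifs <;> simp_all

/-! ### Games that behave like nim heaps -/

/-- `G` has the size `h` as a nim heap: `h` is the minimal excludant of the sizes of the options of
either player, and a game of size `0` has no options at all. -/
def IsHeap : Game → ℕ → Prop
  | .mk L R l r, h =>
    ((h = 0 → IsEmpty L) ∧ (∀ i, ∃ a, a ≠ h ∧ IsHeap (l i) a) ∧ ∀ a < h, ∃ i, IsHeap (l i) a) ∧
    ((h = 0 → IsEmpty R) ∧ (∀ i, ∃ a, a ≠ h ∧ IsHeap (r i) a) ∧ ∀ a < h, ∃ i, IsHeap (r i) a)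

theorem isHeap_iff {G : Game} {h : ℕ} :
    IsHeap G h ↔ ∀ p, (h = 0 → ∀ G', ¬ Opt p G G') ∧
      (∀ G', Opt p G G' → ∃ a, a ≠ h ∧ IsHeap G' a) ∧
      ∀ a < h, ∃ G', Opt p G G' ∧ IsHeap G' a := by
  obtain ⟨L, R, l, r⟩ := G
  constructor
  · rintro h (_ | _)
    · simpa [Opt, isEmpty_iff] using h.1
    · simpa [Opt, isEmpty_iff] using h.2
  · intro h
    exact ⟨by simpa [Opt, isEmpty_iff] using h .left, by simpa [Opt, isEmpty_iff] using h .right⟩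

theorem IsHeap.exists_opt {G : Game} {h : ℕ} (hG : IsHeap G h) (h0 : h ≠ 0) (p : Player) :
    ∃ G', Opt p G G' := by
  obtain ⟨G', hG', -⟩ := ((isHeap_iff.1 hG) p).2.2 0 (Nat.pos_of_ne_zero h0)
  exact ⟨G', hG'⟩

/-- One direction of the strategy transfer. The inductive hypotheses are kept as arguments so that
both directions of the equivalence can use it, although `G` and `H` play different roles in the
induction. -/
theorem IsHeap.winsFirst_add_imp {c : Convention} {G H X : Game} {h : ℕ} (hG : IsHeap G h)
    (hH : IsHeap H h)
    (ihopt : ∀ p G' H' a, Opt p G G' → Opt p H H' → IsHeap G' a → IsHeap H' a → ∀ q,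
      WinsFirst c (G' + X) q ↔ WinsFirst c (H' + X) q)
    (ihrev : ∀ p q G' G'', Opt p G G' → Opt q G' G'' → IsHeap G'' h → ∀ q,
      WinsFirst c (G'' + X) q ↔ WinsFirst c (H + X) q)
    (ihX : ∀ p X', Opt p X X' → ∀ q, WinsFirst c (G + X') q ↔ WinsFirst c (H + X') q)
    (p : Player) (w : WinsFirst c (G + X) p) : WinsFirst c (H + X) p := by
  rw [winsFirst_iff] at w
  rcases w with ⟨hc, hn⟩ | ⟨K, hK, hw⟩
  -- A misère win by having no move transfers only because size 0 excludes options in `H` too.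
  · have h0 : h = 0 := by
      by_contra h0
      obtain ⟨G', hG'⟩ := hG.exists_opt h0 p
      exact hn _ (opt_add.2 (.inl ⟨G', hG', rfl⟩))
    refine winsFirst_iff.2 (.inl ⟨hc, fun K hK => ?_⟩)
    rcases opt_add.1 hK with ⟨H', hH', rfl⟩ | ⟨X', hX', rfl⟩
    · exact ((isHeap_iff.1 hH) p).1 h0 _ hH'
    · exact hn _ (opt_add.2 (.inr ⟨X', hX', rfl⟩))
  · rcases opt_add.1 hK with ⟨G', hG', rfl⟩ | ⟨X', hX', rfl⟩
    · obtain ⟨a, hne, ha⟩ := ((isHeap_iff.1 hG) p).2.1 _ hG'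
      rcases lt_or_gt_of_ne hne with hlt | hgt
      · obtain ⟨H', hH', haH⟩ := ((isHeap_iff.1 hH) p).2.2 a hlt
        refine winsFirst_iff.2 (.inr ⟨H' + X, opt_add.2 (.inl ⟨H', hH', rfl⟩), ?_⟩)
        rwa [← ihopt p G' H' a hG' hH' ha haH]
      -- The opponent could reverse `G'` to some `G''` of size `h`. Since the opponent loses `G' +
      -- X`, that reply must leave `p` winning `G'' + X`, which is equivalent to `H + X`.
      · obtain ⟨G'', hG'', hh⟩ := ((isHeap_iff.1 ha) p.other).2.2 h hgt
        rw [← ihrev _ _ _ _ hG' hG'' hh]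
        by_contra hcon
        refine hw (winsFirst_iff.2 (.inr ⟨G'' + X, opt_add.2 (.inl ⟨G'', hG'', rfl⟩), ?_⟩))
        rwa [Player.other_other]
    · refine winsFirst_iff.2 (.inr ⟨H + X', opt_add.2 (.inr ⟨X', hX', rfl⟩), ?_⟩)
      rwa [← ihX p X' hX']

theorem IsHeap.winsFirst_add_iff {c : Convention} (X G H : Game) {h : ℕ} (hG : IsHeap G h)
    (hH : IsHeap H h) (p : Player) : WinsFirst c (G + X) p ↔ WinsFirst c (H + X) p := by
  induction X using opt_induction generalizing G H h p with
  | step X ihX =>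
  induction G using opt_induction₂ generalizing H h p with
  | step G ihG ihG₂ =>
  induction H using opt_induction₂ generalizing h p with
  | step H ihH ihH₂ =>
  constructor
  · refine hG.winsFirst_add_imp hH ?_ ?_ ?_ p
    · intro p G' H' a h₁ _ h₃ h₄ q
      exact ihG p G' h₁ H' h₃ h₄ q
    · intro p q G' G'' h₁ h₂ h₃ q'
      exact ihG₂ p q G' G'' h₁ h₂ H h₃ hH q'
    · intro p X' h₁ q
      exact ihX p X' h₁ G H hG hH q
  · refine hH.winsFirst_add_imp hG ?_ ?_ ?_ p
    · intro p H' G' a _ h₂ h₃ h₄ q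
      exact (ihG p G' h₂ H' h₄ h₃ q).symm
    · intro p q H' H'' h₁ h₂ h₃ q'
      exact (ihH₂ p q H' H'' h₁ h₂ hG h₃ q').symm
    · intro p X' h₁ q
      exact (ihX p X' h₁ G H hG hH q).symm

/-- Two games of the same heap size are equal under misère play. -/
theorem IsHeap.misereEquiv {G H : Game} {h : ℕ} (hG : IsHeap G h) (hH : IsHeap H h) :
    MisereEquiv G H :=
  fun X => outcome_eq_of_winsFirst_iff (hG.winsFirst_add_iff X G H hH)

/-! ### Tame games -/

/-- The misère Grundy value of a tame game with Grundy value `t.1`, where `t.2` says whether the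
game is fickle. -/
def misereValue (t : ℕ × Bool) : ℕ :=
  if t.2 then t.1 ^^^ 1 else t.1

/-- The condition on the states of the options of a game under which the game has state `t`;
`T i u` says that the `i`-th option has state `u`. -/
def TameOptions {ι : Type} (T : ι → ℕ × Bool → Prop) (t : ℕ × Bool) : Prop :=
  -- States are not assumed unique, so every clause records, for one and the same `u`, what it says
  -- about both values.
  (∀ i, ∃ u, T i u ∧ u.1 ≠ t.1 ∧ misereValue u ≠ misereValue t) ∧
  (∀ c < t.1, ∃ i u, T i u ∧ u.1 = c ∧ misereValue u ≠ misereValue t) ∧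
  -- A finished game has misère value 1 without an option of value 0; the alternative admits it.
  ((∀ c < misereValue t, ∃ i u, T i u ∧ misereValue u = c ∧ u.1 ≠ t.1) ∨
    IsEmpty ι) ∧
  (IsEmpty ι → t.2 = true)

/-- `G` is a tame game with state `t`: its Grundy value is `t.1` and its misère Grundy value is
`misereValue t`, and `t.2` says that `G` is fickle, i.e. that it behaves like a sum of nim heaps
of size at most `1`. -/
def IsTame : Game → ℕ × Bool → Prop
  | .mk _ _ l r, t => (t.2 = true → t.1 ≤ 1) ∧
      TameOptions (fun i u => IsTame (l i) u) t ∧ TameOptions (fun i u => IsTame (r i) u) t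

theorem isTame_iff {G : Game} {t : ℕ × Bool} :
    IsTame G t ↔ (t.2 = true → t.1 ≤ 1) ∧ ∀ p,
      (∀ G', Opt p G G' → ∃ u, IsTame G' u ∧ u.1 ≠ t.1 ∧ misereValue u ≠ misereValue t) ∧
      (∀ c < t.1, ∃ G' u, Opt p G G' ∧ IsTame G' u ∧ u.1 = c ∧ misereValue u ≠ misereValue t) ∧
      ((∀ c < misereValue t, ∃ G' u, Opt p G G' ∧ IsTame G' u ∧ misereValue u = c ∧ u.1 ≠ t.1) ∨
        ∀ G', ¬ Opt p G G') ∧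
      ((∀ G', ¬ Opt p G G') → t.2 = true) := by
  obtain ⟨L, R, l, r⟩ := G
  constructor
  · rintro ⟨h₀, h₁, h₂⟩
    refine ⟨h₀, ?_⟩
    rintro (_ | _)
    · simpa [Opt, isEmpty_iff, TameOptions] using h₁
    · simpa [Opt, isEmpty_iff, TameOptions] using h₂
  · rintro ⟨h₀, h⟩
    exact ⟨h₀, by simpa [Opt, isEmpty_iff, TameOptions] using h .left,
      by simpa [Opt, isEmpty_iff, TameOptions] using h .right⟩

/-- The state of a nim heap. -/
def heapState (h : ℕ) : ℕ × Bool :=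
  (h, decide (h ≤ 1))

/-- The misère Grundy value of a nim heap is obtained by exchanging `0` and `1`. -/
theorem misereValue_heapState (h : ℕ) :
    misereValue (heapState h) = Equiv.swap 0 1 h := by
  rcases h with _ | _ | h <;> simp [misereValue, heapState, Equiv.swap_apply_def]

theorem IsHeap.isTame {G : Game} {h : ℕ} (hG : IsHeap G h) : IsTame G (heapState h) := by
  induction G using opt_induction generalizing h with
  | step G ih =>
  refine isTame_iff.2 ⟨by simp [heapState], fun p => ?_⟩
  obtain ⟨h₁, h₂, h₃⟩ := (isHeap_iff.1 hG) p
  refine ⟨fun G' hG' => ?_, fun c hc => ?_, ?_, fun hn => ?_⟩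
  · obtain ⟨a, hne, ha⟩ := h₂ G' hG'
    exact ⟨_, ih p G' hG' ha, hne, by simpa [misereValue_heapState] using hne⟩
  · obtain ⟨G', hG', ha⟩ := h₃ c hc
    exact ⟨G', _, hG', ih p G' hG' ha, rfl, by
      simpa [misereValue_heapState] using (show c ≠ h from hc.ne)⟩
  · rcases eq_or_ne h 0 with h0 | h0
    · exact .inr (h₁ h0)
    · refine .inl fun c hc => ?_
      -- A heap of misère value `c` has size `swap 0 1 c`. For `h = 1` there is no such `c`; for `h
      -- ≥ 2` the swap permutes the numbers below `h`.
      have hlt : Equiv.swap 0 1 c < h := by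
        rw [misereValue_heapState] at hc
        simp only [Equiv.swap_apply_def] at hc ⊢
        split_ifs at hc ⊢ <;> omega
      obtain ⟨G', hG', ha⟩ := h₃ _ hlt
      exact ⟨G', _, hG', ih p G' hG' ha, by simp [misereValue_heapState], hlt.ne⟩
  · rcases eq_or_ne h 0 with h0 | h0
    · simp [heapState, h0]
    · obtain ⟨G', hG'⟩ := hG.exists_opt h0 p
      exact absurd hG' (hn _)

/-- Tameness sees only options. The game of a sum of positions matches the sum of their games option
by option, so no equality between the two is needed. -/
theorem isTame_of_bisimulation {R : Game → Game → Prop}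
    (hR : ∀ G H, R G H → ∀ p, (∀ G', Opt p G G' → ∃ H', Opt p H H' ∧ R G' H') ∧
      ∀ H', Opt p H H' → ∃ G', Opt p G G' ∧ R G' H')
    {G H : Game} (h : R G H) {t : ℕ × Bool} (hG : IsTame G t) : IsTame H t := by
  induction G using opt_induction generalizing H t with
  | step G ih =>
  obtain ⟨h₀, hp⟩ := isTame_iff.1 hG
  refine isTame_iff.2 ⟨h₀, fun p => ?_⟩
  obtain ⟨forth, back⟩ := hR G H h p
  obtain ⟨h₁, h₂, h₃, h₄⟩ := hp p
  refine ⟨fun H' hH' => ?_, fun c hc => ?_, h₃.imp (fun h₃ c hc => ?_) fun hn H' hH' => ?_,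
    fun hn => h₄ fun G' hG' => ?_⟩
  · obtain ⟨G', hG', hr⟩ := back H' hH'
    obtain ⟨u, hu, hu'⟩ := h₁ G' hG'
    exact ⟨u, ih p G' hG' hr hu, hu'⟩
  · obtain ⟨G', u, hG', hu, hu'⟩ := h₂ c hc
    obtain ⟨H', hH', hr⟩ := forth G' hG'
    exact ⟨H', u, hH', ih p G' hG' hr hu, hu'⟩
  · obtain ⟨G', u, hG', hu, hu'⟩ := h₃ c hc
    obtain ⟨H', hH', hr⟩ := forth G' hG'
    exact ⟨H', u, hH', ih p G' hG' hr hu, hu'⟩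
  · obtain ⟨G', hG', -⟩ := back H' hH'
    exact hn _ hG'
  · obtain ⟨H', hH', -⟩ := forth G' hG'
    exact hn _ hH'

theorem IsTame.eq_zero_of_forall_not_opt {G : Game} {t : ℕ × Bool} (hG : IsTame G t) {p : Player}
    (hn : ∀ G', ¬ Opt p G G') : t = (0, true) := by
  obtain ⟨-, h₂, -, h₄⟩ := (isTame_iff.1 hG).2 p
  refine Prod.ext (by_contra fun h => ?_) (h₄ hn)
  obtain ⟨G', u, hG', -⟩ := h₂ 0 (Nat.pos_of_ne_zero h)
  exact hn _ hG'

theorem IsTame.winsFirst_normal {G : Game} {t : ℕ × Bool} (hG : IsTame G t) (p : Player) :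
    WinsFirst .normal G p ↔ t.1 ≠ 0 := by
  induction G using opt_induction generalizing t p with
  | step G ih =>
  obtain ⟨h₁, h₂, -⟩ := (isTame_iff.1 hG).2 p
  rw [winsFirst_iff]
  constructor
  · rintro (⟨h, -⟩ | ⟨G', hG', hw⟩)
    · cases h
    · obtain ⟨u, hu, hne, -⟩ := h₁ G' hG'
      rw [ih p G' hG' hu, not_not] at hw
      omega
  · intro h
    obtain ⟨G', u, hG', hu, hu0, -⟩ := h₂ 0 (Nat.pos_of_ne_zero h)
    exact .inr ⟨G', hG', by rw [ih p G' hG' hu, hu0]; simp⟩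

theorem IsTame.winsFirst_misere {G : Game} {t : ℕ × Bool} (hG : IsTame G t) (p : Player) :
    WinsFirst .misere G p ↔ misereValue t ≠ 0 := by
  induction G using opt_induction generalizing t p with
  | step G ih =>
  obtain ⟨h₁, -, h₃, -⟩ := (isTame_iff.1 hG).2 p
  rw [winsFirst_iff]
  constructor
  · rintro (⟨-, hn⟩ | ⟨G', hG', hw⟩)
    · rw [hG.eq_zero_of_forall_not_opt hn]
      simp [misereValue]
    · obtain ⟨u, hu, -, hne⟩ := h₁ G' hG'
      rw [ih p G' hG' hu, not_not] at hw
      omega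
  · intro h
    rcases h₃ with h₃ | hn
    · obtain ⟨G', u, hG', hu, hu0, -⟩ := h₃ 0 (Nat.pos_of_ne_zero h)
      exact .inr ⟨G', hG', by rw [ih p G' hG' hu, hu0]; simp⟩
    · exact .inl ⟨rfl, hn⟩

/-! ### Sums of tame games -/

/-- The state of a sum of two tame games. -/
def addState (t u : ℕ × Bool) : ℕ × Bool :=
  (t.1 ^^^ u.1, t.2 && u.2)

theorem addState_comm (t u : ℕ × Bool) : addState t u = addState u t := by
  simp [addState, Nat.xor_comm, Bool.and_comm]

theorem addState_left_fst_ne {t t' : ℕ × Bool} (u : ℕ × Bool) (h : t'.1 ≠ t.1) :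
    (addState t' u).1 ≠ (addState t u).1 := by
  simpa [addState] using h

theorem misereValue_addState_of_snd {u : ℕ × Bool} (hu : u.2 = true) (t : ℕ × Bool) :
    misereValue (addState t u) = misereValue t ^^^ u.1 := by
  rcases t with ⟨a, _ | _⟩ <;> simp [misereValue, addState, hu, Nat.xor_comm, Nat.xor_left_comm,
    Nat.xor_assoc]

theorem misereValue_addState_of_not_snd {u : ℕ × Bool} (hu : u.2 = false) (t : ℕ × Bool) :
    misereValue (addState t u) = (addState t u).1 := by
  simp [misereValue, addState, hu]

/-- Beside a firm `u` the normal values decide, beside a fickle one the misère values. This is why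
tameness tracks both inequalities. -/
theorem misereValue_addState_left_ne {t t' : ℕ × Bool} (u : ℕ × Bool) (h : t'.1 ≠ t.1)
    (h' : misereValue t' ≠ misereValue t) :
    misereValue (addState t' u) ≠ misereValue (addState t u) := by
  cases hu : u.2
  · rw [misereValue_addState_of_not_snd hu, misereValue_addState_of_not_snd hu]
    exact addState_left_fst_ne u h
  · rw [misereValue_addState_of_snd hu, misereValue_addState_of_snd hu]
    simpa using h'

theorem snd_eq_true_of_misereValue_ne {t : ℕ × Bool} (h : misereValue t ≠ t.1) : t.2 = true := by
  rcases t with ⟨a, _ | _⟩ <;> simp_all [misereValue]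

theorem IsTame.exists_opt_addState_fst {G : Game} {t u : ℕ × Bool} (hG : IsTame G t) (p : Player)
    {c : ℕ} (hc : c ^^^ u.1 < t.1) :
    ∃ G' t', Opt p G G' ∧ IsTame G' t' ∧ (addState t' u).1 = c ∧
      misereValue (addState t' u) ≠ misereValue (addState t u) := by
  obtain ⟨G', t', hG', ht', hv, hm⟩ := ((isTame_iff.1 hG).2 p).2.1 _ hc
  exact ⟨G', t', hG', ht', by simp [addState, hv], misereValue_addState_left_ne u (by omega) hm⟩

theorem IsTame.exists_opt_misereValue_of_not_snd {G : Game} {t u : ℕ × Bool} (hG : IsTame G t)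
    (p : Player) (hu : u.2 = false) {c : ℕ} (hc : c ^^^ u.1 < t.1) :
    ∃ G' t', Opt p G G' ∧ IsTame G' t' ∧ misereValue (addState t' u) = c ∧
      (addState t' u).1 ≠ (addState t u).1 := by
  obtain ⟨G', t', hG', ht', hv, hm⟩ := ((isTame_iff.1 hG).2 p).2.1 _ hc
  refine ⟨G', t', hG', ht', ?_, addState_left_fst_ne u (by omega)⟩
  rw [misereValue_addState_of_not_snd hu]
  simp [addState, hv]

theorem IsTame.exists_opt_misereValue_of_snd {G : Game} {t u : ℕ × Bool} (hG : IsTame G t)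
    (p : Player) (hu : u.2 = true) {c : ℕ} (hc : c ^^^ u.1 < misereValue t) :
    (∃ G' t', Opt p G G' ∧ IsTame G' t' ∧ misereValue (addState t' u) = c ∧
      (addState t' u).1 ≠ (addState t u).1) ∨ ∀ G', ¬ Opt p G G' := by
  refine ((isTame_iff.1 hG).2 p).2.2.1.imp_left fun h => ?_
  obtain ⟨G', t', hG', ht', hv, hm⟩ := h _ hc
  refine ⟨G', t', hG', ht', ?_, addState_left_fst_ne u hm⟩
  simp [misereValue_addState_of_snd hu, hv]

/-- In a sum of two fickle games of Grundy value `1`, there is a move to misère Grundy value `0`. -/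
theorem IsTame.exists_opt_misereValue_zero {G : Game} {t u : ℕ × Bool} (hG : IsTame G t)
    (p : Player) (ht : t = (1, true)) (hu : u = (1, true)) :
    ∃ G' t', Opt p G G' ∧ IsTame G' t' ∧ misereValue (addState t' u) = 0 ∧
      (addState t' u).1 ≠ (addState t u).1 := by
  subst ht hu
  -- The misère clause is vacuous, as `G` has misère value 0. The option of normal value 0 has
  -- nonzero misère value, hence is fickle.
  obtain ⟨G', t', hG', ht', hv, hm⟩ := ((isTame_iff.1 hG).2 p).2.1 0 one_pos
  have hs : t'.2 = true := snd_eq_true_of_misereValue_ne (by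
    rw [hv]
    exact hm)
  refine ⟨G', t', hG', ht', ?_, addState_left_fst_ne _ (by simp [hv])⟩
  simp [misereValue, addState, hv, hs]

/-- Unless both games are fickle, the misère value of the sum is a xor of values of the summands,
and the nim argument finds the summand to move in. Firm games are never finished, so the exceptional
clause cannot interfere. -/
theorem IsTame.exists_opt_add_misereValue {G H : Game} {t u : ℕ × Bool} (hG : IsTame G t)
    (hH : IsTame H u) (p : Player) {c : ℕ} (hc : c < misereValue (addState t u)) :
    (∃ G' t', Opt p G G' ∧ IsTame G' t' ∧ misereValue (addState t' u) = c ∧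
      (addState t' u).1 ≠ (addState t u).1) ∨
    (∃ H' u', Opt p H H' ∧ IsTame H' u' ∧ misereValue (addState u' t) = c ∧
      (addState u' t).1 ≠ (addState u t).1) ∨
    (∀ G', ¬ Opt p G G') ∧ ∀ H', ¬ Opt p H H' := by
  cases hu : u.2 <;> cases ht : t.2
  · rw [misereValue_addState_of_not_snd hu] at hc
    rcases Nat.lt_xor_cases hc with hc | hc
    · exact .inl (hG.exists_opt_misereValue_of_not_snd p hu hc)
    · exact .inr (.inl (hH.exists_opt_misereValue_of_not_snd p ht hc))
  · rw [addState_comm, misereValue_addState_of_snd ht] at hc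
    rcases Nat.lt_xor_cases hc with hc | hc
    · rcases hH.exists_opt_misereValue_of_snd p ht hc with h | h
      · exact .inr (.inl h)
      · simp [hH.eq_zero_of_forall_not_opt h] at hu
    · simp only [misereValue, hu] at hc
      exact .inl (hG.exists_opt_misereValue_of_not_snd p hu hc)
  · rw [misereValue_addState_of_snd hu] at hc
    rcases Nat.lt_xor_cases hc with hc | hc
    · rcases hG.exists_opt_misereValue_of_snd p hu hc with h | h
      · exact .inl h
      · simp [hG.eq_zero_of_forall_not_opt h] at ht
    · simp only [misereValue, ht] at hc
      exact .inr (.inl (hH.exists_opt_misereValue_of_not_snd p ht hc))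
  · have ha := (isTame_iff.1 hG).1 ht
    have hb := (isTame_iff.1 hH).1 hu
    obtain ⟨a, f⟩ := t
    obtain ⟨b, g⟩ := u
    simp only at ha hb ht hu
    subst ht hu
    -- Only the values 0, 0 and 1, 1 give the sum a positive misère value, namely 1.
    interval_cases a <;> interval_cases b <;> simp [misereValue, addState] at hc
    · subst hc
      rcases hG.exists_opt_misereValue_of_snd (u := (0, true)) (c := 0) p rfl (by decide) with h | h
      · exact .inl h
      · rcases hH.exists_opt_misereValue_of_snd (u := (0, true)) (c := 0) p rfl (by decide)
          with h' | h'
        · exact .inr (.inl h')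
        · exact .inr (.inr ⟨h, h'⟩)
    · subst hc
      exact .inl (hG.exists_opt_misereValue_zero p rfl rfl)

theorem IsTame.add {G H : Game} {t u : ℕ × Bool} (hG : IsTame G t) (hH : IsTame H u) :
    IsTame (G + H) (addState t u) := by
  induction G using opt_induction generalizing H t u with
  | step G ihG =>
  induction H using opt_induction generalizing u with
  | step H ihH =>
  refine isTame_iff.2 ⟨fun h => ?_, fun p => ⟨fun K hK => ?_, fun c hc => ?_, ?_, fun hn => ?_⟩⟩
  · simp only [addState, Bool.and_eq_true] at h
    have ha := (isTame_iff.1 hG).1 h.1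
    have hb := (isTame_iff.1 hH).1 h.2
    simp only [addState]
    generalize t.1 = a at ha
    generalize u.1 = b at hb
    interval_cases a <;> interval_cases b <;> decide
  · rcases opt_add.1 hK with ⟨G', hG', rfl⟩ | ⟨H', hH', rfl⟩
    · obtain ⟨t', ht', h₁, h₂⟩ := ((isTame_iff.1 hG).2 p).1 _ hG'
      exact ⟨_, ihG p G' hG' ht' hH, addState_left_fst_ne u h₁,
        misereValue_addState_left_ne u h₁ h₂⟩
    · obtain ⟨u', hu', h₁, h₂⟩ := ((isTame_iff.1 hH).2 p).1 _ hH'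
      refine ⟨_, ihH p H' hH' hu', ?_⟩
      rw [addState_comm t, addState_comm t]
      exact ⟨addState_left_fst_ne t h₁, misereValue_addState_left_ne t h₁ h₂⟩
  · rcases Nat.lt_xor_cases hc with hc | hc
    · obtain ⟨G', t', hG', ht', h⟩ := hG.exists_opt_addState_fst p hc
      exact ⟨_, _, opt_add.2 (.inl ⟨G', hG', rfl⟩), ihG p G' hG' ht' hH, h⟩
    · obtain ⟨H', u', hH', hu', h⟩ := hH.exists_opt_addState_fst p hc
      refine ⟨_, _, opt_add.2 (.inr ⟨H', hH', rfl⟩), ihH p H' hH' hu', ?_⟩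
      rwa [addState_comm t, addState_comm t]
  · by_cases hn : (∀ G', ¬ Opt p G G') ∧ ∀ H', ¬ Opt p H H'
    · refine .inr fun K hK => ?_
      rcases opt_add.1 hK with ⟨G', hG', -⟩ | ⟨H', hH', -⟩
      · exact hn.1 _ hG'
      · exact hn.2 _ hH'
    · refine .inl fun c hc => ?_
      rcases hG.exists_opt_add_misereValue hH p hc with
        ⟨G', t', hG', ht', h⟩ | ⟨H', u', hH', hu', h⟩ | h
      · exact ⟨_, _, opt_add.2 (.inl ⟨G', hG', rfl⟩), ihG p G' hG' ht' hH, h⟩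
      · refine ⟨_, _, opt_add.2 (.inr ⟨H', hH', rfl⟩), ihH p H' hH' hu', ?_⟩
        rwa [addState_comm t, addState_comm t]
      · exact absurd h hn
  · rw [hG.eq_zero_of_forall_not_opt (p := p) fun G' h => hn _ (opt_add.2 (.inl ⟨G', h, rfl⟩)),
      hH.eq_zero_of_forall_not_opt (p := p) fun H' h => hn _ (opt_add.2 (.inr ⟨H', h, rfl⟩))]
    rfl

/-! ### Hackenbush positions -/

/-- The player `p` may cut edges of this colour. -/
def Player.MayCut : Player → Color → Prop
  | .left, c => c ≠ .red
  | .right, c => c ≠ .blue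

theorem Player.mayCut_green (p : Player) : p.MayCut .green := by
  cases p <;> simp [MayCut]

namespace Position

theorem opt_gameFrom {P : Position} {s : Finset P.E} {p : Player} {G : Game} :
    Opt p (P.gameFrom s) G ↔ ∃ e ∈ s, p.MayCut (P.color e) ∧ G = P.gameFrom (P.cut s e) := by
  rw [gameFrom]
  cases p <;> simp [Opt, Player.MayCut, eq_comm, and_assoc]

theorem mem_prune {P : Position} {s : Finset P.E} {f : P.E} :
    f ∈ P.prune s ↔ f ∈ s ∧ ∃ v ∈ P.ends f, P.Reached s v := by
  simp [prune]

theorem cut_eq_prune {P : Position} {s s' : Finset P.E} {e : P.E}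
    (h : ∀ f, f ∈ s' ↔ f ≠ e ∧ f ∈ s) : P.cut s e = P.prune s' := by
  classical
  rw [cut]
  congr 1
  ext f
  simp [h]

theorem reached_of_mem_ground {P : Position} (s : Finset P.E) {v : P.V} (hv : v ∈ P.ground) :
    P.Reached s v :=
  ⟨v, hv, .refl⟩

theorem Reached.step {P : Position} {s : Finset P.E} {v w : P.V} (hv : P.Reached s v) {e : P.E}
    (he : e ∈ s) (h : P.ends e = s(v, w)) : P.Reached s w := by
  obtain ⟨g, hg, hr⟩ := hv
  exact ⟨g, hg, hr.tail ⟨e, he, h⟩⟩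

theorem Reached.induction {P : Position} {s : Finset P.E} {C : P.V → Prop}
    (ground : ∀ v ∈ P.ground, C v)
    (step : ∀ v w, ∀ e ∈ s, P.ends e = s(v, w) → C v → C w) {v : P.V} (h : P.Reached s v) :
    C v := by
  obtain ⟨g, hg, hr⟩ := h
  induction hr with
  | refl => exact ground g hg
  | tail _ h ih =>
    obtain ⟨e, he, h⟩ := h
    exact step _ _ e he h ih

/-! ### Shrubs -/

theorem IsShrub.exists_root_edge {P : Position} (hP : P.IsShrub) :
    ∃ r e₀, P.ground = {r} ∧ ∀ e, r ∈ P.ends e ↔ e = e₀ := by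
  obtain ⟨-, r, hr, hd⟩ := hP
  -- Loops are among the incident edges, so total degree 1 forces exactly one incident edge.
  have hle : Nat.card {e : P.E // P.ends e = s(r, r)} ≤ Nat.card {e : P.E // r ∈ P.ends e} :=
    Nat.card_le_card_of_injective (fun e => ⟨e.1, by rw [e.2]; simp⟩)
      fun a b h => Subtype.ext (by simpa using h)
  have h1 : Nat.card {e : P.E // r ∈ P.ends e} = 1 := by
    unfold degree at hd
    omega
  obtain ⟨hs, ⟨e₀, h₀⟩⟩ := Nat.card_eq_one_iff_unique.1 h1
  refine ⟨r, e₀, hr, fun e => ⟨fun he => ?_, ?_⟩⟩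
  · exact congrArg Subtype.val (hs.elim ⟨e, he⟩ ⟨e₀, h₀⟩)
  · rintro rfl
    exact h₀

theorem cut_root_edge {P : Position} {r : P.V} {e₀ : P.E} (hr : P.ground = {r})
    (h₀ : ∀ e, r ∈ P.ends e ↔ e = e₀) (s : Finset P.E) : P.cut s e₀ = ∅ := by
  classical
  rw [cut_eq_prune (s' := s.erase e₀) (by simp)]
  refine Finset.eq_empty_of_forall_notMem fun f hf => ?_
  obtain ⟨hf, v, hv, hreach⟩ := mem_prune.1 hf
  have hvr : v = r := by
    refine hreach.induction (C := (· = r)) (fun v hv => by simpa [hr] using hv) ?_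
    rintro v w e he hends rfl
    have h : e = e₀ := (h₀ e).1 (by simp [hends])
    subst h
    exact absurd he (Finset.notMem_erase _ _)
  subst hvr
  exact Finset.ne_of_mem_erase hf ((h₀ f).1 hv)

theorem isHeap_gameFrom_empty (P : Position) : IsHeap (P.gameFrom ∅) 0 := by
  have hn : ∀ p G', ¬ Opt p (P.gameFrom ∅) G' := by simp [opt_gameFrom]
  exact isHeap_iff.2 fun p => ⟨fun _ => hn p, fun G' hG' => absurd hG' (hn p G'), by simp⟩

/-- The mex rule for green positions in which some edge can be cut to leave nothing. -/
theorem exists_isHeap_gameFrom {P : Position} (hg : ∀ e, P.color e = .green) {s : Finset P.E}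
    {e₀ : P.E} (h₀ : e₀ ∈ s) (hcut : P.cut s e₀ = ∅)
    (h : ∀ e ∈ s, e ≠ e₀ → ∃ a, IsHeap (P.gameFrom (P.cut s e)) a) :
    ∃ a, IsHeap (P.gameFrom s) a := by
  classical
  -- Forcing the value 0 at `e₀` puts 0 among the option sizes and makes the mex positive. The value
  -- outside `s` is a dummy.
  have h' : ∀ e, ∃ a, (e ∈ s → IsHeap (P.gameFrom (P.cut s e)) a) ∧ (e = e₀ → a = 0) := by
    intro e
    by_cases he : e = e₀
    · subst he
      exact ⟨0, fun _ => hcut ▸ isHeap_gameFrom_empty P, fun _ => rfl⟩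
    · by_cases hes : e ∈ s
      · obtain ⟨a, ha⟩ := h e hes he
        exact ⟨a, fun _ => ha, fun h => absurd h he⟩
      · exact ⟨0, fun h => absurd h hes, fun _ => rfl⟩
  choose val hval hval₀ using h'
  have hex : ∃ m, m ∉ s.image val := Infinite.exists_notMem_finset _
  refine ⟨Nat.find hex, isHeap_iff.2 fun p => ⟨fun h0 => ?_, fun G' hG' => ?_, fun a ha => ?_⟩⟩
  · refine absurd (Nat.find_spec hex) ?_
    rw [h0, not_not]
    exact Finset.mem_image.2 ⟨e₀, h₀, hval₀ e₀ rfl⟩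
  · obtain ⟨e, he, -, rfl⟩ := opt_gameFrom.1 hG'
    refine ⟨val e, fun heq => Nat.find_spec hex ?_, hval e he⟩
    rw [← heq]
    exact Finset.mem_image_of_mem _ he
  · obtain ⟨e, he, rfl⟩ := Finset.mem_image.1 (not_not.1 (Nat.find_min hex ha))
    exact ⟨_, opt_gameFrom.2 ⟨e, he, hg e ▸ p.mayCut_green, rfl⟩, hval e he⟩

/-- The root edge touches the ground, so it survives every other cut and the induction on the number
of edges continues. -/
theorem exists_isHeap_gameFrom_of_root_edge {P : Position} (hg : ∀ e, P.color e = .green)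
    {r : P.V} {e₀ : P.E} (hr : P.ground = {r}) (h₀ : ∀ e, r ∈ P.ends e ↔ e = e₀)
    {s : Finset P.E} (hs : e₀ ∈ s) : ∃ a, IsHeap (P.gameFrom s) a := by
  induction hn : s.card using Nat.strong_induction_on generalizing s with
  | _ n ih =>
  subst hn
  refine exists_isHeap_gameFrom hg hs (cut_root_edge hr h₀ s) fun e he hne => ?_
  refine ih _ (P.card_cut_lt s e he) ?_ rfl
  classical
  rw [cut_eq_prune (s' := s.erase e) (by simp), mem_prune]
  exact ⟨Finset.mem_erase.2 ⟨hne.symm, hs⟩, r, (h₀ e₀).2 rfl, reached_of_mem_ground _ (by simp [hr])⟩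

theorem IsShrub.exists_isHeap {P : Position} (hP : P.IsShrub) : ∃ a, IsHeap P.game a := by
  obtain ⟨r, e₀, hr, h₀⟩ := hP.exists_root_edge
  refine exists_isHeap_gameFrom_of_root_edge hP.1 hr h₀ ?_
  exact mem_prune.2 ⟨Finset.mem_univ _, r, (h₀ e₀).2 rfl, reached_of_mem_ground _ (by simp [hr])⟩

/-! ### Stalks -/

theorem stalk_reached {n : ℕ} {s : Finset (Fin n)} {k : ℕ} (hs : ∀ j : Fin n, j.1 < k → j ∈ s)
    (v : Fin (n + 1)) (hv : v.1 ≤ k) : (stalk n).Reached s v := by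
  induction v using Fin.induction with
  | zero => exact reached_of_mem_ground (P := stalk n) s (Set.mem_singleton _)
  | succ j ih =>
    have hj : j.1 < k := by simpa using hv
    exact (ih (by simpa using hj.le)).step (P := stalk n) (e := j) (hs j hj) rfl

/-- Edge `k` joins vertices `k` and `k + 1`; without it no path climbs past vertex `k`. -/
theorem stalk_le_of_reached {n : ℕ} {s : Finset (Fin n)} {k : Fin n} (hk : k ∉ s)
    {v : Fin (n + 1)} (hv : (stalk n).Reached s v) : v.1 ≤ k.1 := by
  refine hv.induction (P := stalk n) (C := fun v : Fin (n + 1) => v.1 ≤ k.1) ?_ ?_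
  · intro v hv
    rw [show v = (0 : Fin (n + 1)) from hv]
    simp
  · intro v w (e : Fin n) he h hv
    have hne : e.1 ≠ k.1 := fun h => hk (Fin.ext h ▸ he)
    replace h : s(e.castSucc, e.succ) = s(v, w) := h
    rcases Sym2.eq_iff.1 h with ⟨rfl, rfl⟩ | ⟨rfl, rfl⟩
    · simp only [Fin.val_castSucc, Fin.val_succ] at hv ⊢
      omega
    · simp only [Fin.val_castSucc, Fin.val_succ] at hv ⊢
      omega

theorem stalk_cut {n i : ℕ} {k : Fin n} (hk : k.1 < i) :
    (stalk n).cut (Finset.univ.filter fun j : Fin n => j.1 < i) k =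
      (Finset.univ.filter fun j : Fin n => j.1 < k.1 : Finset (Fin n)) := by
  have herase (f : Fin n) : f ∈ (Finset.univ.filter fun j : Fin n => j.1 < i).erase k ↔
      f ≠ k ∧ f ∈ Finset.univ.filter fun j : Fin n => j.1 < i := Finset.mem_erase
  refine (cut_eq_prune (P := stalk n) herase).trans ?_
  refine Finset.ext fun (f : Fin n) => mem_prune.trans ⟨?_, fun hf => ?_⟩
  · rintro ⟨hf, v, hv, hreach⟩
    have hne' : f.1 ≠ k.1 := fun h =>
      Finset.ne_of_mem_erase (α := Fin n) hf (Fin.ext h)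
    have hle := stalk_le_of_reached (k := k)
      (Finset.notMem_erase k (Finset.univ.filter fun j : Fin n => j.1 < i)) hreach
    replace hv : v ∈ s(f.castSucc, f.succ) := hv
    refine Finset.mem_filter.2 ⟨Finset.mem_univ _, ?_⟩
    rcases Sym2.mem_iff.1 hv with rfl | rfl
    · simp only [Fin.val_castSucc] at hle
      omega
    · simp only [Fin.val_succ] at hle
      omega
  · have hlt : ∀ j : Fin n, j.1 < k.1 →
        j ∈ (Finset.univ.filter fun j : Fin n => j.1 < i).erase k := fun j hj =>
      Finset.mem_erase.2 ⟨fun h => hj.ne (congrArg Fin.val h),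
        Finset.mem_filter.2 ⟨Finset.mem_univ _, by omega⟩⟩
    have hf : f.1 < k.1 := (Finset.mem_filter.1 hf).2
    exact ⟨hlt f hf, f.castSucc, Sym2.mem_mk_left _ _,
      stalk_reached (k := k.1) hlt _ (by simpa using hf.le)⟩

theorem isHeap_stalk_gameFrom {n i : ℕ} (hi : i ≤ n) :
    IsHeap ((stalk n).gameFrom (Finset.univ.filter fun j : Fin n => j.1 < i)) i := by
  induction i using Nat.strong_induction_on with
  | _ i ih =>
  refine isHeap_iff.2 fun p => ⟨fun h0 G' hG' => ?_, fun G' hG' => ?_, fun a ha => ?_⟩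
  · obtain ⟨(e : Fin n), he, -⟩ := opt_gameFrom.1 hG'
    have := (Finset.mem_filter.1 he).2
    omega
  · obtain ⟨(e : Fin n), he, -, rfl⟩ := opt_gameFrom.1 hG'
    have he := (Finset.mem_filter.1 he).2
    refine ⟨e.1, he.ne, ?_⟩
    rw [stalk_cut he]
    exact ih _ he (by omega)
  · refine ⟨_, opt_gameFrom.2 ⟨(⟨a, by omega⟩ : Fin n),
      Finset.mem_filter.2 ⟨Finset.mem_univ _, ha⟩, p.mayCut_green, rfl⟩, ?_⟩
    rw [stalk_cut (k := ⟨a, by omega⟩) ha]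
    exact ih _ ha (by omega)

theorem isHeap_stalk (n : ℕ) : IsHeap (stalk n).game n := by
  have h : (stalk n).prune Finset.univ = (Finset.univ.filter fun j : Fin n => j.1 < n) := by
    refine Finset.ext fun (f : Fin n) => mem_prune.trans ⟨fun _ => ?_, fun _ => ?_⟩
    · exact Finset.mem_filter.2 ⟨Finset.mem_univ _, f.2⟩
    · exact ⟨Finset.mem_univ _, f.castSucc, Sym2.mem_mk_left _ _,
        stalk_reached (k := n) (fun j _ => Finset.mem_univ j) _ (by simp)⟩
  rw [game, h]
  exact isHeap_stalk_gameFrom le_rfl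

/-! ### Sums of positions -/

/-- By `hclosed` the image of `P` is a union of components of `K`, so no path enters it from
outside. -/
theorem reached_iff_of_embedding {P K : Position} {φ : P.V → K.V} {ψ : P.E → K.E}
    (hφ : Function.Injective φ) (hends : ∀ e, K.ends (ψ e) = (P.ends e).map φ)
    (hground : ∀ v, φ v ∈ K.ground ↔ v ∈ P.ground) {s : Finset P.E} {S : Finset K.E}
    (hS : ∀ e, ψ e ∈ S ↔ e ∈ s) (hclosed : ∀ e v, φ v ∈ K.ends e → ∃ e', ψ e' = e) {v : P.V} :
    K.Reached S (φ v) ↔ P.Reached s v := by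
  constructor
  · intro h
    refine h.induction (C := fun x => ∀ v, x = φ v → P.Reached s v) ?_ ?_ v rfl
    · rintro _ hv v rfl
      exact reached_of_mem_ground s ((hground v).1 hv)
    · rintro x y e he h hx v rfl
      -- The last edge of the path ends in the image, so it comes from `P`, and its other end lies
      -- in the image too.
      obtain ⟨e, rfl⟩ := hclosed e v (by simp [h])
      rw [hends] at h
      induction hw : P.ends e with
      | _ w w' =>
      rw [hw, Sym2.map_mk, Sym2.eq_iff] at h
      rcases h with ⟨h, h'⟩ | ⟨h, h'⟩
      · obtain rfl := hφ h'
        exact (hx w h.symm).step ((hS e).1 he) hw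
      · obtain rfl := hφ h
        exact (hx w' h'.symm).step ((hS e).1 he) (hw.trans Sym2.eq_swap)
  · intro h
    refine h.induction (C := fun v => K.Reached S (φ v)) ?_ ?_
    · intro v hv
      exact reached_of_mem_ground _ ((hground v).2 hv)
    · intro v w e he h hv
      refine hv.step ((hS e).2 he) ?_
      rw [hends, h, Sym2.map_mk]

theorem mem_prune_iff_of_embedding {P K : Position} {φ : P.V → K.V} {ψ : P.E → K.E}
    (hφ : Function.Injective φ) (hends : ∀ e, K.ends (ψ e) = (P.ends e).map φ)
    (hground : ∀ v, φ v ∈ K.ground ↔ v ∈ P.ground) {s : Finset P.E} {S : Finset K.E}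
    (hS : ∀ e, ψ e ∈ S ↔ e ∈ s) (hclosed : ∀ e v, φ v ∈ K.ends e → ∃ e', ψ e' = e) {e : P.E} :
    ψ e ∈ K.prune S ↔ e ∈ P.prune s := by
  rw [mem_prune, mem_prune, hS, hends]
  simp only [Sym2.mem_map, exists_exists_and_eq_and]
  simp only [reached_iff_of_embedding hφ hends hground hS hclosed]

theorem inl_mem_prune_add {P Q : Position} {s : Finset P.E} {S : Finset (P.add Q).E}
    (hS : ∀ e, (Sum.inl e : P.E ⊕ Q.E) ∈ S ↔ e ∈ s) {e : P.E} :
    (Sum.inl e : P.E ⊕ Q.E) ∈ (P.add Q).prune S ↔ e ∈ P.prune s := by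
  refine mem_prune_iff_of_embedding (K := P.add Q) (φ := Sum.inl) (ψ := Sum.inl)
    Sum.inl_injective (fun _ => rfl) (fun v => ?_) hS ?_
  · exact ⟨by rintro (⟨w, hw, h⟩ | ⟨w, hw, h⟩) <;> cases h; exact hw, fun h => .inl ⟨v, h, rfl⟩⟩
  · rintro (e | e) v h
    · exact ⟨e, rfl⟩
    · obtain ⟨w, -, hw⟩ := Sym2.mem_map.1 (show Sum.inl v ∈ (Q.ends e).map Sum.inr from h)
      cases hw

theorem inr_mem_prune_add {P Q : Position} {t : Finset Q.E} {S : Finset (P.add Q).E}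
    (hS : ∀ e, (Sum.inr e : P.E ⊕ Q.E) ∈ S ↔ e ∈ t) {e : Q.E} :
    (Sum.inr e : P.E ⊕ Q.E) ∈ (P.add Q).prune S ↔ e ∈ Q.prune t := by
  refine mem_prune_iff_of_embedding (K := P.add Q) (φ := Sum.inr) (ψ := Sum.inr)
    Sum.inr_injective (fun _ => rfl) (fun v => ?_) hS ?_
  · exact ⟨by rintro (⟨w, hw, h⟩ | ⟨w, hw, h⟩) <;> cases h; exact hw, fun h => .inr ⟨v, h, rfl⟩⟩
  · rintro (e | e) v h
    · obtain ⟨w, -, hw⟩ := Sym2.mem_map.1 (show Sum.inr v ∈ (P.ends e).map Sum.inl from h)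
      cases hw
    · exact ⟨e, rfl⟩

theorem prune_add {P Q : Position} {s : Finset P.E} {t : Finset Q.E} {S : Finset (P.add Q).E}
    (hs : ∀ e, (Sum.inl e : P.E ⊕ Q.E) ∈ S ↔ e ∈ s)
    (ht : ∀ e, (Sum.inr e : P.E ⊕ Q.E) ∈ S ↔ e ∈ t) :
    (P.add Q).prune S = (P.prune s).disjSum (Q.prune t) := by
  refine Finset.ext ?_
  rintro (e | e)
  · exact (inl_mem_prune_add hs).trans Finset.inl_mem_disjSum.symm
  · exact (inr_mem_prune_add ht).trans Finset.inr_mem_disjSum.symm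

/-- Every edge on a path from the ground has a reached end, so pruning breaks no such path. -/
theorem prune_prune (P : Position) (s : Finset P.E) : P.prune (P.prune s) = P.prune s := by
  have h : ∀ v, P.Reached s v → P.Reached (P.prune s) v := fun v hv => by
    refine (hv.induction (C := fun v => P.Reached s v ∧ P.Reached (P.prune s) v) ?_ ?_).2
    · exact fun v hv => ⟨reached_of_mem_ground _ hv, reached_of_mem_ground _ hv⟩
    · rintro v w e he h ⟨hv, hv'⟩
      exact ⟨hv.step he h, hv'.step (mem_prune.2 ⟨he, v, by simp [h], hv⟩) h⟩
  ext e
  rw [mem_prune, and_iff_left_iff_imp]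
  intro he
  obtain ⟨-, v, hv, hr⟩ := mem_prune.1 he
  exact ⟨v, hv, h v hr⟩

theorem prune_cut (P : Position) (s : Finset P.E) (e : P.E) : P.prune (P.cut s e) = P.cut s e :=
  P.prune_prune _

/-- A cut prunes the whole graph, so the untouched summand must already be pruned. -/
theorem cut_add_inl {P Q : Position} (s : Finset P.E) {t : Finset Q.E} (ht : Q.prune t = t)
    (e : P.E) : (P.add Q).cut (s.disjSum t) (Sum.inl e : P.E ⊕ Q.E) = (P.cut s e).disjSum t := by
  classical
  rw [cut_eq_prune (s' := s.erase e) (by simp)]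
  have h (f : P.E ⊕ Q.E) : f ∈ (s.erase e).disjSum t ↔ f ≠ Sum.inl e ∧ f ∈ s.disjSum t := by
    rcases f with f | f <;> simp
  refine (cut_eq_prune (P := P.add Q) h).trans ?_
  rw [prune_add (s := s.erase e) (t := t) (fun _ => Finset.inl_mem_disjSum)
    (fun _ => Finset.inr_mem_disjSum), ht]

theorem cut_add_inr {P Q : Position} {s : Finset P.E} (t : Finset Q.E) (hs : P.prune s = s)
    (e : Q.E) : (P.add Q).cut (s.disjSum t) (Sum.inr e : P.E ⊕ Q.E) = s.disjSum (Q.cut t e) := by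
  classical
  rw [cut_eq_prune (s' := t.erase e) (by simp)]
  have h (f : P.E ⊕ Q.E) : f ∈ s.disjSum (t.erase e) ↔ f ≠ Sum.inr e ∧ f ∈ s.disjSum t := by
    rcases f with f | f <;> simp
  refine (cut_eq_prune (P := P.add Q) h).trans ?_
  rw [prune_add (s := s) (t := t.erase e) (fun _ => Finset.inl_mem_disjSum)
    (fun _ => Finset.inr_mem_disjSum), hs]

/-- `G` is the sum of the games at a stage of `P` and a stage of `Q`, and `H` is the game of the
corresponding stage of `P.add Q`. -/
def SumStage (P Q : Position) (G H : Game) : Prop :=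
  ∃ s t, P.prune s = s ∧ Q.prune t = t ∧ G = P.gameFrom s + Q.gameFrom t ∧
    H = (P.add Q).gameFrom (s.disjSum t)

theorem SumStage.bisimulation {P Q : Position} {G H : Game} (h : SumStage P Q G H) (p : Player) :
    (∀ G', Opt p G G' → ∃ H', Opt p H H' ∧ SumStage P Q G' H') ∧
      ∀ H', Opt p H H' → ∃ G', Opt p G G' ∧ SumStage P Q G' H' := by
  obtain ⟨s, t, hs, ht, rfl, rfl⟩ := h
  have hl : ∀ e, SumStage P Q (P.gameFrom (P.cut s e) + Q.gameFrom t)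
      ((P.add Q).gameFrom ((P.add Q).cut (s.disjSum t) (Sum.inl e : P.E ⊕ Q.E))) := fun e =>
    ⟨_, t, P.prune_cut s e, ht, rfl, by rw [cut_add_inl s ht]⟩
  have hr : ∀ e, SumStage P Q (P.gameFrom s + Q.gameFrom (Q.cut t e))
      ((P.add Q).gameFrom ((P.add Q).cut (s.disjSum t) (Sum.inr e : P.E ⊕ Q.E))) := fun e =>
    ⟨s, _, hs, Q.prune_cut t e, rfl, by rw [cut_add_inr t hs]⟩
  constructor
  · intro G' hG'
    rcases opt_add.1 hG' with ⟨K, hK, rfl⟩ | ⟨K, hK, rfl⟩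
    · obtain ⟨e, he, hc, rfl⟩ := opt_gameFrom.1 hK
      exact ⟨_, opt_gameFrom.2 ⟨Sum.inl e, Finset.inl_mem_disjSum.2 he, hc, rfl⟩, hl e⟩
    · obtain ⟨e, he, hc, rfl⟩ := opt_gameFrom.1 hK
      exact ⟨_, opt_gameFrom.2 ⟨Sum.inr e, Finset.inr_mem_disjSum.2 he, hc, rfl⟩, hr e⟩
  · intro H' hH'
    obtain ⟨e | e, he, hc, rfl⟩ := opt_gameFrom.1 hH'
    · exact ⟨_, opt_add.2 (.inl ⟨_, opt_gameFrom.2 ⟨e, Finset.inl_mem_disjSum.1 he, hc, rfl⟩, rfl⟩),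
        hl e⟩
    · exact ⟨_, opt_add.2 (.inr ⟨_, opt_gameFrom.2 ⟨e, Finset.inr_mem_disjSum.1 he, hc, rfl⟩, rfl⟩),
        hr e⟩

theorem sumStage_game (P Q : Position) : SumStage P Q (P.game + Q.game) (P.add Q).game :=
  ⟨_, _, P.prune_prune _, Q.prune_prune _, rfl, congrArg _
    (prune_add (fun _ => iff_of_true (Finset.mem_univ _) (Finset.mem_univ _))
      fun _ => iff_of_true (Finset.mem_univ _) (Finset.mem_univ _))⟩

theorem isTame_add {P Q : Position} {t u : ℕ × Bool} (hP : IsTame P.game t)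
    (hQ : IsTame Q.game u) : IsTame (P.add Q).game (addState t u) :=
  isTame_of_bisimulation (fun _ _ h => h.bisimulation) (sumStage_game P Q) (hP.add hQ)

theorem isHeap_zero : IsHeap zero.game 0 := by
  rw [game, show zero.prune Finset.univ = ∅ from Finset.eq_empty_of_forall_notMem Empty.rec]
  exact isHeap_gameFrom_empty _

/-! ### The evil twin -/

theorem outcome_ne_of_misere {G H : Game} {t u : ℕ × Bool} (hG : IsTame G t) (hH : IsTame H u)
    (ht : misereValue t = 0) (hu : misereValue u ≠ 0) :
    outcome .misere G ≠ outcome .misere H := by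
  simp [outcome, hG.winsFirst_misere, hH.winsFirst_misere, ht, hu]

/-- For `n ≥ 2` the context `H` separates: both sums are firm, and the nim sum vanishes for `H + H`
but not for `G + H`. Sizes 0 and 1 are separated by the empty context. -/
theorem not_misereEquiv_of_lt {G H : Game} {m n : ℕ} (hG : IsHeap G m) (hH : IsHeap H n)
    (h : m < n) : ¬ MisereEquiv G H := by
  intro he
  rcases Nat.lt_or_ge n 2 with hn | hn
  · obtain rfl : n = 1 := by omega
    obtain rfl : m = 0 := by omega
    refine outcome_ne_of_misere (hH.isTame.add isHeap_zero.isTame) (hG.isTame.add isHeap_zero.isTame)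
      (by decide) (by decide) (he zero.game).symm
  · refine outcome_ne_of_misere (hH.isTame.add hH.isTame) (hG.isTame.add hH.isTame) ?_ ?_
      (he H).symm
    · rw [misereValue_addState_of_not_snd (by simpa [heapState] using Nat.lt_of_succ_le hn)]
      simp [addState]
    · rw [misereValue_addState_of_not_snd (by simpa [heapState] using Nat.lt_of_succ_le hn)]
      simpa [addState, heapState, Nat.xor_eq_zero_iff] using h.ne

theorem equivStalk_iff {P : Position} {h n : ℕ} (hP : IsHeap P.game h) :
    P.EquivStalk n ↔ n = h := by
  constructor
  · intro he
    by_contra hne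
    rcases lt_or_gt_of_ne hne with hlt | hlt
    · exact not_misereEquiv_of_lt (isHeap_stalk n) hP hlt fun X => (he X).symm
    · exact not_misereEquiv_of_lt hP (isHeap_stalk n) hlt he
  · rintro rfl
    exact hP.misereEquiv (isHeap_stalk n)

theorem exists_isTame_sum {l : List Position} (hl : ∀ S ∈ l, S.IsShrub) :
    ∃ t, IsTame (sum l).game t ∧ (t.2 = false ↔ ∃ S ∈ l, ∃ n, 2 ≤ n ∧ S.EquivStalk n) := by
  induction l with
  | nil => exact ⟨_, isHeap_zero.isTame, by simp [heapState]⟩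
  | cons S l ih =>
    obtain ⟨t, ht, hf⟩ := ih fun T hT => hl T (List.mem_cons_of_mem S hT)
    obtain ⟨h, hS⟩ := (hl S List.mem_cons_self).exists_isHeap
    refine ⟨_, isTame_add hS.isTame ht, ?_⟩
    have h' : (∃ n, 2 ≤ n ∧ S.EquivStalk n) ↔ 2 ≤ h := by simp [equivStalk_iff hS]
    rw [List.exists_mem_cons_iff, h', ← hf]
    simp only [addState, heapState, Bool.and_eq_false_iff, decide_eq_false_iff_not, not_le]
    rfl

theorem outcome_normal_eq_misere {G H : Game} {t u : ℕ × Bool} (hG : IsTame G t)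
    (hH : IsTame H u) (h : t.1 = misereValue u) : outcome .normal G = outcome .misere H :=
  outcome_eq_of_winsFirst_iff fun p => by rw [hG.winsFirst_normal, hH.winsFirst_misere, h]

end Position

end Hackenbush

open Hackenbush Position in
/-- For every disjunctive sum `S` of Shrubs, each summand is equivalent to exactly one Stalk (so
that the evil twin `S*` is well defined), `o⁺(S) = o⁻(S*)` and `o⁺(S*) = o⁻(S)`. -/
theorem theorem2p4 (l : List Hackenbush.Position) (hl : ∀ S ∈ l, S.IsShrub) :
    (∀ S ∈ l, ∃! n : ℕ, S.EquivStalk n) ∧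
    (Hackenbush.Position.sum l).outcomeNormal =
      (Hackenbush.Position.evilTwin l).outcomeMisere ∧
    (Hackenbush.Position.evilTwin l).outcomeNormal =
      (Hackenbush.Position.sum l).outcomeMisere := by
  refine ⟨fun S hS => ?_, ?_⟩
  · obtain ⟨h, hh⟩ := (hl S hS).exists_isHeap
    simp [equivStalk_iff hh]
  · obtain ⟨t, ht, hf⟩ := exists_isTame_sum hl
    rw [evilTwin]
    split_ifs with hex
    · rw [← hf] at hex
      -- Some height is at least 2, so the sum is firm and its two values agree.
      have heq : t.1 = misereValue t := by simp [misereValue, hex]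
      exact ⟨outcome_normal_eq_misere ht ht heq, outcome_normal_eq_misere ht ht heq⟩
    · rw [← hf, Bool.not_eq_false] at hex
      -- The sum is fickle and stays so after adding `*`, which xors both values with 1 and thereby
      -- exchanges them.
      have hstar := isTame_add ht (isHeap_stalk 1).isTame
      refine ⟨outcome_normal_eq_misere ht hstar ?_, outcome_normal_eq_misere hstar ht ?_⟩
      · rw [misereValue_addState_of_snd rfl]
        simp [misereValue, hex, heapState]
      · simp [misereValue, hex, heapState, addState]
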